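/- **Setting.** Let $N,L,L_C,L_F,\lambda,\Lambda$ be natural numbers with $\lambda,\Lambda\ge 1$, $\lfloor\Lambda/\lambda\rfloor\le N$, $L_F\le L$ and $L_C+L_F\le T:=L-L_F+1$. Let $\theta\in\mathbb{R}^D$, $\eta\neq 0$, $\sigma>0$, $C>0$, let $f_\theta$ be an arbitrary parametric model on context windows in $\mathbb{R}^{L_C}$ and $\mathcal{L}$ an arbitrary real-valued loss comparing a model output with a forecast window in $\mathbb{R}^{L_F}$. A dataset is a family $x=(x_1,\dots,x_N)$ of series $x_n\in\mathbb{R}^L$. Write $x\simeq x'$ if $x$ and $x'$ differ in at most one series, and there in at most one time index. For distributions $P\ll Q$ and $\alpha\ge 0$ let $H_\alpha(P\|Q)=\int\max\{\frac{dP}{dQ}-\alpha,0\}\,dQ$. Let $\mathit{MoG}(\mu,p,\sigma)=\sum_k p_k\,\mathcal{N}(\mu_k,\sigma^2)$. **Mechanism.** A training step $\tilde M$ maps $x$ to the random vector in $\mathbb{R}^D$ obtained as follows. 1. (Top level, without replacement.) Draw a uniformly random permutation $\pi$ of $\{1,\dots,N\}$ and select $x_{\pi(1)},\dots,x_{\pi(N')}$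 with $N'=\lfloor\Lambda/\lambda\rfloor$. 2. (Bottom level.) Independently for each selected series, prepend $L_C$ zeros and choose starting indices in $\{1,\dots,T\}$: either $\lambda$ independent uniform indices (*sampling with replacement*), or each index independently with probability $\min\{1,\lambda/T\}$ (*Poisson sampling*). Each chosen index $t$ contributes to the batch (a multiset) the length-$(L_C+L_F)$ subsequence of the padded series that starts at $t$. 3. (Noisy step.) For each batch element $a$, with first $L_C$ entries $a_C$ and last $L_F$ entries $a_F$, let $g_a=\nabla_\theta\mathcal{L}(f_\theta(a_C),a_F)$ (read as $0$ if the gradient does not exist) and clip it to $g_a/\max\{1,\|g_a\|_2/C\}$. With $\hat g$ the sum of the clipped gradients and $Z\sim\mathcal{N}(0,\sigma^2C^2 I)$, output $\theta-\eta\cdot\frac1\Lambda(\hat g+Z)$. Let $\tilde M_x$ be the law of the output, let $\tilde H(\alpha)=\sup_{x\simeq x'}H_\alpha(\tilde M_x\|\tilde M_{x'})$ be the per-step privacy profile, and let $\rho=\lfloor\Lambda/\lambda\rfloor/N$ (with $\rho=0$ if $N=0$). **Theorem.** For every $\alpha\ge 0$, $$\tilde H(\alpha)\le(1-\rho)\cdot\max\{0,1-\alpha\}+\rho\cdot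 H_\alpha(P\|Q),\qquad P=\mathit{MoG}(-\mu,p,\sigma),\quad Q=\mathit{MoG}(\mu,p,\sigma),$$ where * for bottom-level sampling with replacement, $\mu=(0,2,4,\dots,2\lambda)$ and $p_i=\binom{\lambda}{i-1}r^{i-1}(1-r)^{\lambda-i+1}$ for $1\le i\le\lambda+1$, with $r=\frac{L_C+L_F}{L-L_F+1}$; * for bottom-level Poisson sampling, $\mu=(0,1,\dots,L_C+L_F)$ and $p_i=\binom{L_C+L_F}{i-1}r^{i-1}(1-r)^{L_C+L_F-i+1}$ for $1\le i\le L_C+L_F+1$, with $r=\min\{1,\lambda/(L-L_F+1)\}$. -/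

import Mathlib

open MeasureTheory ProbabilityTheory
open scoped ENNReal NNReal

namespace BilevelForecasting

/-! ### Privacy notions -/

/-- Hockey stick divergence `H_α(P ‖ Q) = ∫ max {dP/dQ - α, 0} dQ` (for `P` absolutely continuous
with respect to `Q`), with values in `[0, ∞]`. The subtraction of `ℝ≥0∞` is truncated at `0`. -/
noncomputable def hockeyStick {E : Type*} [MeasurableSpace E] (α : ℝ) (P Q : Measure E) : ℝ≥0∞ :=
  ∫⁻ o, (P.rnDeriv Q o - ENNReal.ofReal α) ∂Q

/-- The univariate mixture of Gaussians with means `μ`, weights `p` and common standard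
deviation `σ`. -/
noncomputable def MoG {K : ℕ} (μ p : Fin K → ℝ) (σ : ℝ) : Measure ℝ :=
  ∑ k, ENNReal.ofReal (p k) • gaussianReal (μ k) ⟨σ ^ 2, sq_nonneg σ⟩

/-- The probability of the outcome `i` under the binomial distribution with `n` trials and success
probability `r`. -/
def binomialWeight (n : ℕ) (r : ℝ) (i : ℕ) : ℝ := n.choose i * r ^ i * (1 - r) ^ (n - i)

/-- A time series of length `L`. -/
abbrev Series (L : ℕ) := Fin L → ℝ

/-- A dataset `x = {x_1, …, x_N}` of `N` time series of length `L`. -/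
abbrev Dataset (N L : ℕ) := Fin N → Series L

/-- `w`-event-level neighbouring datasets: they differ in at most one pair of sequences
`x_n, x'_n`, and these differ only inside one range of indices of length `w`. -/
def EventNeighbors {N L : ℕ} (w : ℕ) (x x' : Dataset N L) : Prop :=
  ∃ n : Fin N, (∀ m, m ≠ n → x m = x' m) ∧
    ∃ t : Fin L, ∀ i : Fin L, ¬ ((t : ℕ) ≤ i ∧ (i : ℕ) < t + w) → x n i = x' n i

/-- The privacy profile `α ↦ sup_{x ≃ x'} H_α(M_x ‖ M_{x'})` under `1`-event-level privacy of a
mechanism, given as the map from datasets to output distributions. -/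
noncomputable def privacyProfile {N L : ℕ} {E : Type*} [MeasurableSpace E]
    (M : Dataset N L → Measure E) (α : ℝ) : ℝ≥0∞ :=
  ⨆ (x : Dataset N L) (x' : Dataset N L) (_ : EventNeighbors 1 x x'), hockeyStick α (M x) (M x')

/-! ### Bottom-level sampling -/

/-- The sequence `x` with `LC` zeros prepended (and continued by `0`; this continuation is never
read). Indices start at `0`. -/
def prependZeros {L : ℕ} (LC : ℕ) (x : Series L) (i : ℕ) : ℝ :=
  if h : LC ≤ i ∧ i - LC < L then x ⟨i - LC, h.2⟩ else 0

/-- The subsequence of length `LC + LF` of the padded sequence that starts at `t`; the admissible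
starting points are the `L - LF + 1` elements of `Fin (L - LF + 1)`. -/
def crop {L : ℕ} (LC LF : ℕ) (x : Series L) (t : Fin (L - LF + 1)) : Fin (LC + LF) → ℝ :=
  fun j => prependZeros LC x (t + j)

/-- Bottom-level sampling with replacement: `lam` independent uniform starting points. -/
noncomputable def sampleWithReplacement {L : ℕ} (LC LF lam : ℕ) (x : Series L) :
    PMF (Multiset (Fin (LC + LF) → ℝ)) :=
  (PMF.uniformOfFintype (Fin lam → Fin (L - LF + 1))).map fun t =>
    Finset.univ.val.map fun j => crop LC LF x (t j)

/-- The random subset of `Fin T` that contains each element independently with probability `r`. -/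
noncomputable def poissonSubset (T : ℕ) (r : ℝ≥0) (hr : r ≤ 1) : PMF (Finset (Fin T)) :=
  PMF.ofFintype (fun s => (r : ℝ≥0∞) ^ s.card * (1 - (r : ℝ≥0∞)) ^ (T - s.card)) (by
    rw [Fin.sum_pow_mul_eq_add_pow, add_tsub_cancel_of_le (by exact_mod_cast hr), one_pow])

/-- Bottom-level Poisson sampling: each of the `L - LF + 1` starting points is included
independently with probability `min {1, lam / (L - LF + 1)}`. -/
noncomputable def samplePoisson {L : ℕ} (LC LF lam : ℕ) (x : Series L) :
    PMF (Multiset (Fin (LC + LF) → ℝ)) :=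
  (poissonSubset (L - LF + 1) (min 1 ((lam : ℝ≥0) / ((L - LF + 1 : ℕ) : ℝ≥0)))
    (min_le_left _ _)).map fun s => s.val.map (crop LC LF x)

/-! ### The training step -/

/-- Independent draws from the given distributions, aggregated into a single multiset. -/
noncomputable def aggregate {A : Type*} : List (PMF (Multiset A)) → PMF (Multiset A)
  | [] => PMF.pure 0
  | p :: ps => p.bind fun s => (aggregate ps).map fun y => s + y

/-- The bi-level sample: top-level sampling without replacement of `N'` of the `N` sequences,
through a uniformly random permutation `π`, followed by independent bottom-level sampling from
each of `x_{π(1)}, …, x_{π(N')}`. -/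
noncomputable def sampleBatch {N N' L : ℕ} {A : Type*} (h : N' ≤ N)
    (bottom : Series L → PMF (Multiset A)) (x : Dataset N L) : PMF (Multiset A) :=
  (PMF.uniformOfFintype (Equiv.Perm (Fin N))).bind fun π =>
    aggregate ((List.finRange N').map fun n => bottom (x (π (Fin.castLE h n))))

/-- The gradient `∇_θ ℒ(f_θ(a_C), a_F)` for a subsequence `a`, where the context window `a_C`
consists of the first `LC` and the forecast window `a_F` of the last `LF` elements of `a`. -/
noncomputable def subsequenceGradient {D LC LF : ℕ} {O : Type*}
    (f : EuclideanSpace ℝ (Fin D) → (Fin LC → ℝ) → O) (loss : O → (Fin LF → ℝ) → ℝ)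
    (θ : EuclideanSpace ℝ (Fin D)) (a : Fin (LC + LF) → ℝ) : EuclideanSpace ℝ (Fin D) :=
  gradient (fun ϑ => loss (f ϑ fun i => a (Fin.castAdd LF i)) fun i => a (Fin.natAdd LC i)) θ

/-- Gradient clipping to norm `C`. -/
noncomputable def clip {D : ℕ} (C : ℝ) (g : EuclideanSpace ℝ (Fin D)) :
    EuclideanSpace ℝ (Fin D) :=
  (max 1 (‖g‖ / C))⁻¹ • g

/-- The output distribution of the noisy training step on the batch `y`, i.e. the law of
`θ - η g̃` with `g̃ = (ĝ + Z) / Lam`, where `ĝ` is the sum of the clipped gradients and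
`Z ~ N(0, σ² C² I)`. -/
noncomputable def noisyTrainingStep {D LC LF : ℕ} {O : Type*}
    (f : EuclideanSpace ℝ (Fin D) → (Fin LC → ℝ) → O) (loss : O → (Fin LF → ℝ) → ℝ)
    (θ : EuclideanSpace ℝ (Fin D)) (η σ C : ℝ) (Lam : ℕ) (y : Multiset (Fin (LC + LF) → ℝ)) :
    Measure (EuclideanSpace ℝ (Fin D)) :=
  (stdGaussian (EuclideanSpace ℝ (Fin D))).map fun z =>
    θ - η • ((1 / (Lam : ℝ)) •
      ((y.map fun a => clip C (subsequenceGradient f loss θ a)).sum + (σ * C) • z))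

/-- The law of a random element of `κ b`, where `b` is drawn from `p`. -/
noncomputable def mixture {B E : Type*} [MeasurableSpace E] (p : PMF B) (κ : B → Measure E) :
    Measure E :=
  Measure.sum fun b => p b • κ b

/-- The output distribution of a single training step with top-level sampling without replacement
of `⌊Lam / lam⌋` sequences and with the given bottom-level sampling. -/
noncomputable def trainingStep {N L D LC LF : ℕ} {O : Type*} {lam Lam : ℕ} (h : Lam / lam ≤ N)
    (bottom : Series L → PMF (Multiset (Fin (LC + LF) → ℝ)))
    (f : EuclideanSpace ℝ (Fin D) → (Fin LC → ℝ) → O) (loss : O → (Fin LF → ℝ) → ℝ)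
    (θ : EuclideanSpace ℝ (Fin D)) (η σ C : ℝ) (x : Dataset N L) :
    Measure (EuclideanSpace ℝ (Fin D)) :=
  mixture (sampleBatch h bottom x) (noisyTrainingStep f loss θ η σ C Lam)

/-! ### The bottom-level dominating pairs -/

/-- Mean vector `0, 2, …, 2 lam` and binomial weights for sampling with replacement; the sign
`s = -1` gives the first distribution of the pair and `s = 1` the second. -/
noncomputable def pairWithReplacement (s : ℝ) (L LC LF lam : ℕ) (σ : ℝ) : Measure ℝ :=
  MoG (K := lam + 1) (fun i => s * (2 * (i : ℝ)))
    (fun i => binomialWeight lam (((LC + LF : ℕ) : ℝ) / ((L - LF + 1 : ℕ) : ℝ)) i) σ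

/-- Mean vector `0, 1, …, LC + LF` and binomial weights for Poisson sampling; the sign
`s = -1` gives the first distribution of the pair and `s = 1` the second. -/
noncomputable def pairPoisson (s : ℝ) (L LC LF lam : ℕ) (σ : ℝ) : Measure ℝ :=
  MoG (K := LC + LF + 1) (fun i => s * (i : ℝ))
    (fun i => binomialWeight (LC + LF) (min 1 ((lam : ℝ) / ((L - LF + 1 : ℕ) : ℝ))) i) σ

end BilevelForecasting

/-!
By the Cameron–Martin formula, the density of a shifted standard Gaussian is monotone in the
direction of the shift. Hence, by the Neyman–Pearson argument, the test `B` is dominated by a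
half-line `S` of the same null probability: every shift by at most `t` gives `B` at most the
probability of `S` under mean `-t`, and at least that under mean `t`. Since `S` does not depend on
the shifts, it serves all components of a mixture at once, although their centers differ.

At the bottom level, the two modified series agree off a window `W` of `LC + LF` starting points.
Drawing the sample first as if it avoided `W` and then resampling the part in `W` reproduces its
law. Given the first stage, the gradient sums for both series stay within distance `C m` of a
common center, where `m` is the number of starting points in `W` (twice that number when the points
in `W` replace others), and this number is binomial. Averaging over the first stage preserves the
bound by joint convexity.

At the top level, the modified series is selected with probability `ρ`; otherwise the two outputs
have the same law, for which the bound `max 0 (1 - α)` is trivial. Joint convexity again averages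
the two cases over the permutation.
-/

namespace BilevelForecasting

section GaussianShift

theorem map_eq_gaussianReal_of_mgf {Ω : Type*} [MeasurableSpace Ω] {P : Measure Ω}
    [IsFiniteMeasure P] {X : Ω → ℝ} (hX : AEMeasurable X P) {m : ℝ} {v : ℝ≥0}
    (h : ∀ t, mgf X P t = Real.exp (m * t + v * t ^ 2 / 2)) : P.map X = gaussianReal m v := by
  have hmgf : mgf id (gaussianReal m v) = mgf X P := by
    rw [mgf_id_gaussianReal]
    exact funext fun t => (h t).symm
  have hstrip := eqOn_complexMGF_of_mgf hmgf
  rw [integrableExpSet_id_gaussianReal, interior_univ] at hstrip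
  rw [← Measure.ext_of_complexMGF_eq aemeasurable_id hX
    (funext fun z => hstrip (Set.mem_univ z.re)), Measure.map_id]

variable {E : Type*} [NormedAddCommGroup E] [InnerProductSpace ℝ E] [FiniteDimensional ℝ E]
  [MeasurableSpace E] [BorelSpace E]

theorem stdGaussian_map_inner (w : E) :
    (stdGaussian E).map (inner ℝ w) = gaussianReal 0 (‖w‖₊ ^ 2) := by
  have h := IsGaussian.map_eq_gaussianReal (μ := stdGaussian E) (innerSL ℝ w)
  rw [integral_strongDual_stdGaussian, variance_dual_stdGaussian, innerSL_apply_norm,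
    Real.toNNReal_pow (norm_nonneg w), norm_toNNReal] at h
  exact h

theorem mgf_inner_stdGaussian (w : E) (t : ℝ) :
    mgf (inner ℝ w) (stdGaussian E) t = Real.exp (‖w‖ ^ 2 * t ^ 2 / 2) := by
  rw [mgf_gaussianReal (stdGaussian_map_inner w)]
  simp

theorem integral_exp_inner_stdGaussian (w : E) :
    ∫ z, Real.exp (inner ℝ w z) ∂(stdGaussian E) = Real.exp (‖w‖ ^ 2 / 2) := by
  simpa [mgf] using mgf_inner_stdGaussian w 1

theorem integrable_exp_inner_stdGaussian (w : E) :
    Integrable (fun z => Real.exp (inner ℝ w z)) (stdGaussian E) :=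
  .of_integral_ne_zero (by rw [integral_exp_inner_stdGaussian]; exact (Real.exp_pos _).ne')

theorem ext_of_map_inner {P Q : Measure E} [IsFiniteMeasure P] [IsFiniteMeasure Q]
    (h : ∀ w : E, P.map (inner ℝ w) = Q.map (inner ℝ w)) : P = Q := by
  refine Measure.ext_of_charFunDual (funext fun ℓ => ?_)
  obtain ⟨w, rfl⟩ := (InnerProductSpace.toDual ℝ E).surjective ℓ
  rw [charFunDual_eq_charFun_map_one, charFunDual_eq_charFun_map_one]
  exact congrArg (charFun · 1) (h w)

theorem stdGaussian_map_add_right (v : E) :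
    (stdGaussian E).map (· + v) = (stdGaussian E).tilted (inner ℝ v) := by
  have := isProbabilityMeasure_tilted (integrable_exp_inner_stdGaussian v)
  have := Measure.isProbabilityMeasure_map (μ := stdGaussian E) (f := (· + v)) (by fun_prop)
  refine ext_of_map_inner fun w => ?_
  have htilted : ((stdGaussian E).tilted (inner ℝ v)).map (inner ℝ w) =
      gaussianReal (inner ℝ w v) (‖w‖₊ ^ 2) := by
    refine map_eq_gaussianReal_of_mgf (by fun_prop) fun t => ?_
    have hsum (z : E) : inner ℝ v z + t * inner ℝ w z = inner ℝ (v + t • w) z := by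
      rw [inner_add_left, real_inner_smul_left]
    simp only [mgf]
    rw [integral_exp_tilted]
    simp only [Pi.add_apply, hsum]
    rw [integral_exp_inner_stdGaussian, integral_exp_inner_stdGaussian, ← Real.exp_sub,
      norm_add_sq_real, inner_smul_right, norm_smul, real_inner_comm, mul_pow, Real.norm_eq_abs,
      sq_abs]
    congr 1
    push_cast
    ring
  rw [htilted, Measure.map_map (by fun_prop) (by fun_prop)]
  have hcomp : (inner ℝ w) ∘ (· + v) = (· + inner ℝ w v) ∘ inner ℝ w :=
    funext fun z => inner_add_right w z v
  rw [hcomp, ← Measure.map_map (by fun_prop) (by fun_prop), stdGaussian_map_inner,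
    gaussianReal_map_add_const, zero_add]

theorem setLIntegral_le_setLIntegral_of_density_le {Ω : Type*} [MeasurableSpace Ω]
    {P : Measure Ω} [IsFiniteMeasure P] {f : Ω → ℝ≥0∞} {A B : Set Ω} (hA : MeasurableSet A)
    (hB : MeasurableSet B) (hf : ∀ x ∈ A \ B, ∀ y ∈ B \ A, f x ≤ f y) (hAB : P A ≤ P B) :
    ∫⁻ x in A, f x ∂P ≤ ∫⁻ x in B, f x ∂P := by
  have hdiff : P (A \ B) ≤ P (B \ A) := by
    rw [← measure_inter_add_sdiff A hB, ← measure_inter_add_sdiff B hA, Set.inter_comm B A] at hAB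
    exact (ENNReal.add_le_add_iff_left (measure_ne_top _ _)).1 hAB
  rw [← lintegral_inter_add_sdiff f A hB, ← lintegral_inter_add_sdiff f B hA, Set.inter_comm B A]
  gcongr 1
  calc ∫⁻ x in A \ B, f x ∂P ≤ ∫⁻ _ in A \ B, (⨆ x ∈ A \ B, f x) ∂P :=
        setLIntegral_mono' (hA.diff hB) fun x hx => le_iSup₂ (f := fun x _ => f x) x hx
    _ ≤ (⨆ x ∈ A \ B, f x) * P (B \ A) := by
        rw [setLIntegral_const]
        gcongr
    _ = ∫⁻ _ in B \ A, (⨆ x ∈ A \ B, f x) ∂P := (setLIntegral_const _ _).symm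
    _ ≤ ∫⁻ x in B \ A, f x ∂P :=
        setLIntegral_mono' (hB.diff hA) fun y hy => iSup₂_le fun x hx => hf x hx y hy

theorem tilted_apply_le_of_forall_le {Ω : Type*} [MeasurableSpace Ω] {P : Measure Ω}
    [IsFiniteMeasure P] {f : Ω → ℝ} {A B : Set Ω} (hA : MeasurableSet A) (hB : MeasurableSet B)
    (hf : ∀ x ∈ A \ B, ∀ y ∈ B \ A, f x ≤ f y) (hAB : P A ≤ P B) :
    P.tilted f A ≤ P.tilted f B := by
  rw [tilted_apply' P f hA, tilted_apply' P f hB]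
  refine setLIntegral_le_setLIntegral_of_density_le hA hB (fun x hx y hy => ?_) hAB
  have := hf x hx y hy
  gcongr

theorem exists_isLowerSet_measure_eq (P : Measure ℝ) [IsProbabilityMeasure P]
    [NullSingletonClass P] {p : ℝ≥0∞} (hp : p ≤ 1) : ∃ S : Set ℝ, IsLowerSet S ∧ P S = p := by
  rcases eq_or_ne p 0 with rfl | h0
  · exact ⟨∅, isLowerSet_empty, measure_empty⟩
  rcases hp.eq_or_lt with rfl | h1
  · exact ⟨Set.univ, isLowerSet_univ, measure_univ⟩
  have hcont : Continuous (cdf P) := by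
    refine continuous_iff_continuousAt.2 fun x => ?_
    have hx : ENNReal.ofReal (cdf P x - Function.leftLim (cdf P) x) = 0 := by
      rw [← StieltjesFunction.measure_singleton, measure_cdf, measure_singleton]
    rw [(monotone_cdf P).continuousAt_iff_leftLim_eq_rightLim, StieltjesFunction.rightLim_eq]
    exact ((monotone_cdf P).leftLim_le le_rfl).antisymm
      (sub_nonpos.1 (ENNReal.ofReal_eq_zero.1 hx))
  have hptop : p ≠ ∞ := (h1.trans ENNReal.one_lt_top).ne
  have hp0 : 0 < p.toReal := ENNReal.toReal_pos h0 hptop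
  have hp1 : p.toReal < 1 := (ENNReal.toReal_lt_toReal hptop ENNReal.one_ne_top).2 h1
  obtain ⟨c, hc⟩ := mem_range_of_exists_le_of_exists_ge hcont
    ((tendsto_cdf_atBot P).eventually_le_const hp0).exists
    ((tendsto_cdf_atTop P).eventually_const_le hp1).exists
  refine ⟨Set.Iic c, isLowerSet_Iic c, ?_⟩
  rw [← ofReal_cdf, hc, ENNReal.ofReal_toReal hptop]

theorem gaussianReal_anti_of_isLowerSet {S : Set ℝ} (hS : IsLowerSet S) {m m' : ℝ} (hm : m ≤ m')
    (v : ℝ≥0) : gaussianReal m' v S ≤ gaussianReal m v S := by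
  have hSm : MeasurableSet S := hS.ordConnected.measurableSet
  have hshift := gaussianReal_map_add_const (μ := m) (v := v) (m' - m)
  rw [add_sub_cancel] at hshift
  rw [← hshift, Measure.map_apply (by fun_prop) hSm]
  exact measure_mono fun x hx => hS (le_add_of_nonneg_right (sub_nonneg.2 hm)) hx

theorem stdGaussian_map_add_smul_preimage_inner {e : E} (he : ‖e‖ = 1) (c : ℝ) {S : Set ℝ}
    (hS : MeasurableSet S) :
    (stdGaussian E).map (· + c • e) (inner ℝ e ⁻¹' S) = gaussianReal c 1 S := by
  have he' : ‖e‖₊ = 1 := NNReal.eq he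
  have hcomp : inner ℝ e ∘ (· + c • e) = (· + c) ∘ inner ℝ e := by
    funext z
    simp [inner_add_right, inner_smul_right, he]
  rw [← Measure.map_apply (by fun_prop) hS, Measure.map_map (by fun_prop) (by fun_prop), hcomp,
    ← Measure.map_map (by fun_prop) (by fun_prop), stdGaussian_map_inner,
    gaussianReal_map_add_const, zero_add, he', one_pow]

theorem stdGaussian_preimage_inner {e : E} (he : ‖e‖ = 1) {S : Set ℝ} (hS : MeasurableSet S) :
    stdGaussian E (inner ℝ e ⁻¹' S) = gaussianReal 0 1 S := by
  simpa using stdGaussian_map_add_smul_preimage_inner he 0 hS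

theorem stdGaussian_map_add_smul_le {e : E} (he : ‖e‖ = 1) {c : ℝ} (hc : c ≤ 0) {B : Set E}
    (hB : MeasurableSet B) {S : Set ℝ} (hS : IsLowerSet S)
    (hBS : stdGaussian E B ≤ gaussianReal 0 1 S) :
    (stdGaussian E).map (· + c • e) B ≤ gaussianReal c 1 S := by
  have hSm : MeasurableSet S := hS.ordConnected.measurableSet
  rw [← stdGaussian_map_add_smul_preimage_inner he c hSm, stdGaussian_map_add_right]
  refine tilted_apply_le_of_forall_le hB (measurableSet_preimage (by fun_prop) hSm)
    (fun z hz z' hz' => ?_) (hBS.trans_eq (stdGaussian_preimage_inner he hSm).symm)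
  have hzz' : inner ℝ e z' ≤ inner ℝ e z :=
    le_of_not_ge fun hle => hz.2 (hS hle hz'.1)
  rw [real_inner_smul_left, real_inner_smul_left]
  exact mul_le_mul_of_nonpos_left hzz' hc

theorem le_stdGaussian_map_add_smul {e : E} (he : ‖e‖ = 1) {c : ℝ} (hc : 0 ≤ c) {B : Set E}
    (hB : MeasurableSet B) {S : Set ℝ} (hS : IsLowerSet S)
    (hSB : gaussianReal 0 1 S ≤ stdGaussian E B) :
    gaussianReal c 1 S ≤ (stdGaussian E).map (· + c • e) B := by
  have hSm : MeasurableSet S := hS.ordConnected.measurableSet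
  rw [← stdGaussian_map_add_smul_preimage_inner he c hSm, stdGaussian_map_add_right]
  refine tilted_apply_le_of_forall_le (measurableSet_preimage (by fun_prop) hSm) hB
    (fun z hz z' hz' => ?_) ((stdGaussian_preimage_inner he hSm).trans_le hSB)
  have hzz' : inner ℝ e z ≤ inner ℝ e z' :=
    le_of_not_ge fun hle => hz'.2 (hS hle hz.1)
  rw [real_inner_smul_left, real_inner_smul_left]
  exact mul_le_mul_of_nonneg_left hzz' hc

theorem exists_set_dominating_stdGaussian_map_add {B : Set E} (hB : MeasurableSet B) :
    ∃ S : Set ℝ, MeasurableSet S ∧ ∀ (v : E) (t : ℝ), ‖v‖ ≤ t →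
      (stdGaussian E).map (· + v) B ≤ gaussianReal (-t) 1 S ∧
        gaussianReal t 1 S ≤ (stdGaussian E).map (· + v) B := by
  have := nullSingletonClass_gaussianReal (μ := 0) (v := 1) one_ne_zero
  obtain ⟨S, hS, hSB⟩ := exists_isLowerSet_measure_eq (gaussianReal 0 1)
    (prob_le_one (μ := stdGaussian E) (s := B))
  refine ⟨S, hS.ordConnected.measurableSet, fun v t hvt => ?_⟩
  suffices (stdGaussian E).map (· + v) B ≤ gaussianReal (-‖v‖) 1 S ∧
      gaussianReal ‖v‖ 1 S ≤ (stdGaussian E).map (· + v) B from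
    ⟨this.1.trans (gaussianReal_anti_of_isLowerSet hS (neg_le_neg hvt) 1),
      (gaussianReal_anti_of_isLowerSet hS hvt 1).trans this.2⟩
  rcases eq_or_ne v 0 with rfl | hv
  · simp [hSB]
  have he : ‖‖v‖⁻¹ • v‖ = 1 := norm_smul_inv_norm hv
  have hve : ‖v‖ • ‖v‖⁻¹ • v = v := smul_inv_smul₀ (norm_ne_zero_iff.2 hv) v
  constructor
  · simpa [hve] using stdGaussian_map_add_smul_le ((norm_neg _).trans he)
      (neg_nonpos.2 (norm_nonneg v)) hB hS hSB.ge
  · simpa [hve] using le_stdGaussian_map_add_smul he (norm_nonneg v) hB hS hSB.le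

/-- The law of `u + s Z` for a standard Gaussian vector `Z` in `E`: the output distribution of the
Gaussian mechanism with noise level `s` on a query with value `u`. -/
noncomputable def isoGaussian (s : ℝ) (u : E) : Measure E := (stdGaussian E).map fun z => u + s • z

instance isProbabilityMeasure_isoGaussian (s : ℝ) (u : E) :
    IsProbabilityMeasure (isoGaussian s u) :=
  Measure.isProbabilityMeasure_map (by fun_prop)

theorem map_const_add_isoGaussian (s : ℝ) (c u : E) :
    (isoGaussian s u).map (c + ·) = isoGaussian s (c + u) := by
  rw [isoGaussian, Measure.map_map (by fun_prop) (by fun_prop), isoGaussian]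
  simp only [Function.comp_def, add_assoc]

theorem exists_set_dominating_isoGaussian {σ C : ℝ} (hσ : 0 < σ) (hC : 0 < C) (b : E) {B : Set E}
    (hB : MeasurableSet B) :
    ∃ S : Set ℝ, MeasurableSet S ∧ ∀ (u : E) (t : ℝ), ‖u - b‖ ≤ C * t →
      isoGaussian (σ * C) u B ≤ gaussianReal (-t) (σ ^ 2).toNNReal S ∧
        gaussianReal t (σ ^ 2).toNNReal S ≤ isoGaussian (σ * C) u B := by
  have hs : σ * C ≠ 0 := (mul_pos hσ hC).ne'
  have haff : Measurable fun z : E => b + (σ * C) • z := by fun_prop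
  obtain ⟨S, hS, hdom⟩ := exists_set_dominating_stdGaussian_map_add (haff hB)
  have hscale (t : ℝ) : gaussianReal t (σ ^ 2).toNNReal ((σ⁻¹ * ·) ⁻¹' S) =
      gaussianReal (σ⁻¹ * t) 1 S := by
    rw [← Measure.map_apply (by fun_prop) hS, gaussianReal_map_const_mul]
    congr 2
    exact NNReal.eq (by simp [Real.coe_toNNReal _ (sq_nonneg σ), hσ.ne'])
  have hcenter (u : E) : isoGaussian (σ * C) u B = (stdGaussian E).map
      (· + (σ * C)⁻¹ • (u - b)) ((fun z => b + (σ * C) • z) ⁻¹' B) := by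
    rw [← Measure.map_apply haff hB, Measure.map_map haff (by fun_prop), isoGaussian]
    congr 2
    funext z
    simp only [Function.comp_apply, smul_add, smul_inv_smul₀ hs]
    abel
  refine ⟨(σ⁻¹ * ·) ⁻¹' S, (measurable_const_mul σ⁻¹) hS, fun u t hut => ?_⟩
  rw [hscale, hscale, hcenter, mul_neg]
  refine hdom _ _ ?_
  rw [norm_smul, norm_inv, Real.norm_of_nonneg (mul_pos hσ hC).le, mul_inv, mul_assoc]
  gcongr
  rwa [inv_mul_le_iff₀ hC]

end GaussianShift

section Indistinguishability

variable {B E F : Type*} [MeasurableSpace E] [MeasurableSpace F] {a δ : ℝ≥0∞} {P Q : Measure E}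

/-- One-sided approximate indistinguishability: with `a = exp ε` this is the inequality that
`(ε, δ)`-differential privacy requires of the output distributions `P`, `Q` on two neighbouring
datasets. -/
def Indistinguishable (a δ : ℝ≥0∞) (P Q : Measure E) : Prop :=
  ∀ ⦃A⦄, MeasurableSet A → P A ≤ δ + a * Q A

theorem Indistinguishable.hockeyStick_le [IsFiniteMeasure Q] {α : ℝ}
    (h : Indistinguishable (ENNReal.ofReal α) δ P Q) : hockeyStick α P Q ≤ δ := by
  set A := {o | ENNReal.ofReal α ≤ P.rnDeriv Q o}
  have hA : MeasurableSet A := measurableSet_le measurable_const (P.measurable_rnDeriv Q)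
  have hzero : ∀ o ∈ Aᶜ, P.rnDeriv Q o - ENNReal.ofReal α = 0 :=
    fun o (ho : ¬ _ ≤ _) => tsub_eq_zero_of_le (not_le.1 ho).le
  have hfin : ∫⁻ _ in A, ENNReal.ofReal α ∂Q ≠ ∞ := by
    rw [setLIntegral_const]
    exact ENNReal.mul_ne_top ENNReal.ofReal_ne_top (measure_ne_top Q A)
  calc hockeyStick α P Q
      = ∫⁻ o in A, (P.rnDeriv Q o - ENNReal.ofReal α) ∂Q := by
        rw [hockeyStick, ← lintegral_add_compl _ hA, setLIntegral_congr_fun hA.compl hzero,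
          lintegral_zero, add_zero]
    _ = ∫⁻ o in A, P.rnDeriv Q o ∂Q - ∫⁻ _ in A, ENNReal.ofReal α ∂Q :=
        lintegral_sub measurable_const hfin ((ae_restrict_iff' hA).2 (.of_forall fun _ ho => ho))
    _ ≤ P A - ENNReal.ofReal α * Q A := by
        rw [setLIntegral_const]
        exact tsub_le_tsub_right (Measure.setLIntegral_rnDeriv_le A) _
    _ ≤ δ := tsub_le_iff_right.2 (h hA)

theorem indistinguishable_hockeyStick [IsFiniteMeasure P] [IsFiniteMeasure Q] (hPQ : P ≪ Q)
    (α : ℝ) : Indistinguishable (ENNReal.ofReal α) (hockeyStick α P Q) P Q := fun A _ => by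
  calc P A = ∫⁻ o in A, P.rnDeriv Q o ∂Q := (Measure.setLIntegral_rnDeriv hPQ A).symm
    _ ≤ ∫⁻ o in A, (P.rnDeriv Q o - ENNReal.ofReal α + ENNReal.ofReal α) ∂Q :=
        lintegral_mono fun _ => le_tsub_add
    _ = ∫⁻ o in A, (P.rnDeriv Q o - ENNReal.ofReal α) ∂Q + ENNReal.ofReal α * Q A := by
        rw [lintegral_add_right _ measurable_const, setLIntegral_const]
    _ ≤ hockeyStick α P Q + ENNReal.ofReal α * Q A := by
        gcongr
        exact setLIntegral_le_lintegral _ _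

theorem indistinguishable_self [IsProbabilityMeasure P] (α : ℝ) :
    Indistinguishable (ENNReal.ofReal α) (ENNReal.ofReal (max 0 (1 - α))) P P := fun A _ => by
  have hone : 1 ≤ ENNReal.ofReal (max 0 (1 - α)) + ENNReal.ofReal α := by
    rw [← ENNReal.ofReal_one]
    exact (ENNReal.ofReal_le_ofReal (by linarith [le_max_right 0 (1 - α)])).trans
      ENNReal.ofReal_add_le
  calc P A ≤ (ENNReal.ofReal (max 0 (1 - α)) + ENNReal.ofReal α) * P A :=
        le_mul_of_one_le_left zero_le hone
    _ ≤ ENNReal.ofReal (max 0 (1 - α)) + ENNReal.ofReal α * P A := by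
        rw [add_mul]
        gcongr
        exact mul_le_of_le_one_right zero_le prob_le_one

theorem Indistinguishable.map (h : Indistinguishable a δ P Q) {f : E → F} (hf : Measurable f) :
    Indistinguishable a δ (P.map f) (Q.map f) := fun A hA => by
  rw [Measure.map_apply hf hA, Measure.map_apply hf hA]
  exact h (hf hA)

theorem Indistinguishable.of_forall_exists_dominating {P' Q' : Measure F}
    (h : Indistinguishable a δ P' Q')
    (hdom : ∀ A, MeasurableSet A → ∃ S, MeasurableSet S ∧ P A ≤ P' S ∧ Q' S ≤ Q A) :
    Indistinguishable a δ P Q := fun A hA => by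
  obtain ⟨S, hS, hP, hQ⟩ := hdom A hA
  calc P A ≤ P' S := hP
    _ ≤ δ + a * Q' S := h hS
    _ ≤ δ + a * Q A := by gcongr

theorem mixture_apply (p : PMF B) (κ : B → Measure E) {A : Set E} (hA : MeasurableSet A) :
    mixture p κ A = ∑' b, p b * κ b A := by
  simp only [mixture, Measure.sum_apply _ hA, Measure.smul_apply, smul_eq_mul]

instance isProbabilityMeasure_mixture (p : PMF B) (κ : B → Measure E)
    [∀ b, IsProbabilityMeasure (κ b)] : IsProbabilityMeasure (mixture p κ) where
  measure_univ := by
    rw [mixture_apply p κ .univ]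
    simp only [measure_univ, mul_one, p.tsum_coe]

theorem mixture_absolutelyContinuous (p : PMF B) {κ κ' : B → Measure E} (h : ∀ b, κ b ≪ κ' b) :
    mixture p κ ≪ mixture p κ' := by
  refine .mk fun A hA h0 => ?_
  rw [mixture_apply p _ hA, ENNReal.tsum_eq_zero] at h0 ⊢
  exact fun b => mul_eq_zero.2 ((mul_eq_zero.1 (h0 b)).imp_right fun hb => h b hb)

theorem mixture_pure (b : B) (κ : B → Measure E) : mixture (PMF.pure b) κ = κ b := by
  ext A hA
  rw [mixture_apply _ _ hA, tsum_eq_single b fun b' hb' => by simp [hb']]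
  simp

theorem mixture_bind {B' : Type*} (p : PMF B) (f : B → PMF B') (κ : B' → Measure E) :
    mixture (p.bind f) κ = mixture p fun b => mixture (f b) κ := by
  ext A hA
  simp only [mixture_apply _ _ hA, PMF.bind_apply, ← ENNReal.tsum_mul_left,
    ← ENNReal.tsum_mul_right, mul_assoc]
  exact ENNReal.tsum_comm

theorem mixture_map {B' : Type*} (p : PMF B) (f : B → B') (κ : B' → Measure E) :
    mixture (p.map f) κ = mixture p fun b => κ (f b) := by
  simp only [PMF.map, mixture_bind, Function.comp_apply, mixture_pure]

theorem mixture_comm {B' : Type*} (p : PMF B) (q : PMF B') (κ : B → B' → Measure E) :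
    mixture p (fun b => mixture q (κ b)) = mixture q fun b' => mixture p fun b => κ b b' := by
  ext A hA
  simp only [mixture_apply _ _ hA, ← ENNReal.tsum_mul_left, mul_left_comm]
  exact ENNReal.tsum_comm

theorem map_mixture (p : PMF B) (κ : B → Measure E) {f : E → F} (hf : Measurable f) :
    (mixture p κ).map f = mixture p fun b => (κ b).map f := by
  ext A hA
  simp only [Measure.map_apply hf hA, mixture_apply _ _ hA, mixture_apply _ _ (hf hA)]

theorem indistinguishable_mixture (p : PMF B) {δ : B → ℝ≥0∞} {κ κ' : B → Measure E}
    (h : ∀ b, Indistinguishable a (δ b) (κ b) (κ' b)) :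
    Indistinguishable a (∑' b, p b * δ b) (mixture p κ) (mixture p κ') := fun A hA => by
  rw [mixture_apply p κ hA, mixture_apply p κ' hA, ← ENNReal.tsum_mul_left, ← ENNReal.tsum_add]
  refine ENNReal.tsum_le_tsum fun b => ?_
  rw [mul_left_comm, ← mul_add]
  gcongr
  exact h b hA

theorem indistinguishable_mixture_const (p : PMF B) {κ κ' : B → Measure E}
    (h : ∀ b, Indistinguishable a δ (κ b) (κ' b)) :
    Indistinguishable a δ (mixture p κ) (mixture p κ') := by
  simpa only [ENNReal.tsum_mul_right, p.tsum_coe, one_mul] using indistinguishable_mixture p h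

end Indistinguishability

section Resampling

theorem bind_map_eq_of_involutive {β τ : Type*} (p : PMF β) (q : PMF τ) (F : β → τ → τ)
    (G : β → τ → β) (hinv : Function.Involutive fun z : β × τ => (G z.1 z.2, F z.1 z.2))
    (hpq : ∀ b t, p (G b t) * q (F b t) = p b * q t) : (p.bind fun b => q.map (F b)) = q := by
  classical
  ext t
  calc (p.bind fun b => q.map (F b)) t
      = ∑' z : β × τ, p z.1 * q z.2 * if t = F z.1 z.2 then 1 else 0 := by
        simp only [PMF.bind_apply, PMF.map_apply, ENNReal.tsum_prod', ← ENNReal.tsum_mul_left,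
          mul_ite, mul_one, mul_zero]
    _ = ∑' z : β × τ, p z.1 * q z.2 * if t = z.2 then 1 else 0 := by
        rw [← hinv.toPerm.tsum_eq]
        refine tsum_congr fun z => ?_
        rw [← hpq z.1 z.2]
        exact congrArg _ (congrArg (if t = · then 1 else 0) (congrArg Prod.snd (hinv z)))
    _ = q t := by
        rw [ENNReal.tsum_prod']
        simp [ENNReal.tsum_mul_right]

theorem aggregate_perm {A : Type*} {ps ps' : List (PMF (Multiset A))} (h : ps.Perm ps') :
    aggregate ps = aggregate ps' := by
  induction h with
  | nil => rfl
  | cons p _ ih => rw [aggregate, aggregate, ih]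
  | swap p q ps =>
    simp only [aggregate, PMF.map_bind, PMF.map_comp]
    rw [PMF.bind_comm]
    simp only [Function.comp_def, add_left_comm]
  | trans _ _ ih ih' => exact ih.trans ih'

theorem mixture_aggregate_cons {A E : Type*} [MeasurableSpace E] (p : PMF (Multiset A))
    (ps : List (PMF (Multiset A))) (κ : Multiset A → Measure E) :
    mixture (aggregate (p :: ps)) κ =
      mixture (aggregate ps) fun y => mixture p fun s => κ (s + y) := by
  rw [aggregate, mixture_bind, mixture_comm]
  simp only [mixture_map]

theorem indistinguishable_aggregate {A E ι : Type*} [MeasurableSpace E]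
    {a δ : ℝ≥0∞} {κ : Multiset A → Measure E}
    (hκ : ∀ y, ∃ f : E → E, Measurable f ∧ ∀ s, κ (s + y) = (κ s).map f) {l : List ι}
    (hl : l.Nodup) {i : ι} (hi : i ∈ l) {p p' : ι → PMF (Multiset A)}
    (hp : ∀ j, j ≠ i → p j = p' j)
    (h : Indistinguishable a δ (mixture (p i) κ) (mixture (p' i) κ)) :
    Indistinguishable a δ (mixture (aggregate (l.map p)) κ)
      (mixture (aggregate (l.map p')) κ) := by
  classical
  have hrest : (l.erase i).map p = (l.erase i).map p' :=
    List.map_congr_left fun j hj => hp j (hl.mem_erase_iff.1 hj).1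
  have hfront (p : ι → PMF (Multiset A)) :
      aggregate (l.map p) = aggregate (p i :: (l.erase i).map p) :=
    aggregate_perm ((List.perm_cons_erase hi).map p)
  rw [hfront p, hfront p', hrest, mixture_aggregate_cons, mixture_aggregate_cons]
  refine indistinguishable_mixture_const _ fun y => ?_
  obtain ⟨f, hf, hfκ⟩ := hκ y
  simp only [hfκ, ← map_mixture _ _ hf]
  exact h.map hf

theorem map_uniformOfFintype_eq {Ω X : Type*} [Fintype Ω] [Nonempty Ω] [Fintype X] [Nonempty X]
    (f : Ω → X) (hf : ∀ x y, ∃ e : Ω ≃ Ω, ∀ ω, f (e ω) = y ↔ f ω = x) :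
    (PMF.uniformOfFintype Ω).map f = PMF.uniformOfFintype X := by
  classical
  set q := (PMF.uniformOfFintype Ω).map f
  have hconst (x y : X) : q x = q y := by
    obtain ⟨e, he⟩ := hf x y
    simp only [q, PMF.map_apply, PMF.uniformOfFintype_apply]
    rw [← e.tsum_eq fun ω => if y = f ω then (Fintype.card Ω : ℝ≥0∞)⁻¹ else 0]
    refine tsum_congr fun ω => ?_
    simp only [eq_comm (b := f _), he]
  ext x
  have hsum : Fintype.card X * q x = 1 := by
    rw [← q.tsum_coe, tsum_fintype, Finset.sum_congr rfl fun y _ => hconst y x, Finset.sum_const,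
      Finset.card_univ, nsmul_eq_mul]
  rw [PMF.uniformOfFintype_apply]
  exact ENNReal.eq_inv_of_mul_eq_one_left (by rwa [mul_comm])

theorem map_symm_apply_uniformOfFintype_perm {X : Type*} [Fintype X] [DecidableEq X] [Nonempty X]
    (x : X) : (PMF.uniformOfFintype (Equiv.Perm X)).map (fun π => π.symm x) =
      PMF.uniformOfFintype X :=
  map_uniformOfFintype_eq _ fun y z => ⟨Equiv.mulRight (Equiv.swap y z), fun π => by
    simp only [Equiv.coe_mulRight, Equiv.Perm.mul_def, Equiv.symm_trans_apply, Equiv.symm_swap,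
      Equiv.swap_apply_eq_iff, Equiv.swap_apply_right]⟩

section BinomialCount

open Polynomial

theorem map_apply_eq_coeff {Ω : Type*} [Fintype Ω] (q : PMF Ω) (k : Ω → ℕ) (i : ℕ) :
    q.map k i = (∑ ω, C (q ω) * X ^ k ω : ℝ≥0∞[X]).coeff i := by
  simp only [PMF.map_apply, finsetSum_coeff, coeff_C_mul, coeff_X_pow, mul_ite, mul_one, mul_zero,
    tsum_fintype]
  congr!

theorem map_eq_binomialWeight {Ω : Type*} [Fintype Ω] {q : PMF Ω} {k : Ω → ℕ} {n : ℕ} {r : ℝ}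
    (hr : 0 ≤ r) (hr' : r ≤ 1)
    (h : (∑ ω, C (q ω) * X ^ k ω : ℝ≥0∞[X]) =
      (C (ENNReal.ofReal r) * X + C (ENNReal.ofReal (1 - r))) ^ n) (i : ℕ) :
    q.map k i = ENNReal.ofReal (binomialWeight n r i) := by
  have hterm (m : ℕ) : (C (ENNReal.ofReal r) * X) ^ m * C (ENNReal.ofReal (1 - r)) ^ (n - m) *
      (n.choose m : ℝ≥0∞[X]) = C (ENNReal.ofReal (binomialWeight n r m)) * X ^ m := by
    have hr'' := sub_nonneg.2 hr'
    rw [binomialWeight, ENNReal.ofReal_mul (by positivity), ENNReal.ofReal_mul (by positivity),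
      ENNReal.ofReal_natCast, ENNReal.ofReal_pow hr, ENNReal.ofReal_pow hr'', mul_pow]
    simp only [C_mul, C_pow, map_natCast]
    ring
  rw [map_apply_eq_coeff, h, add_pow]
  simp only [hterm, finsetSum_coeff, coeff_C_mul_X_pow]
  rw [Finset.sum_ite_eq (Finset.range (n + 1)) i]
  split_ifs with hi
  · rfl
  · rw [binomialWeight, Nat.choose_eq_zero_of_lt (by simpa using hi)]
    simp

end BinomialCount

theorem MoG_binomialWeight_eq_mixture {Ω : Type*} {q : PMF Ω} {k : Ω → ℕ} {n : ℕ} {r : ℝ}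
    (hk : ∀ i, q.map k i = ENNReal.ofReal (binomialWeight n r i)) (m : ℕ → ℝ) (σ : ℝ) :
    MoG (K := n + 1) (fun i => m i) (fun i => binomialWeight n r i) σ =
      mixture q fun ω => gaussianReal (m (k ω)) (σ ^ 2).toNNReal := by
  have hv : (⟨σ ^ 2, sq_nonneg σ⟩ : ℝ≥0) = (σ ^ 2).toNNReal :=
    (Real.toNNReal_of_nonneg (sq_nonneg σ)).symm
  rw [← mixture_map q k fun i => gaussianReal (m i) (σ ^ 2).toNNReal]
  ext A hA
  have htail (i : ℕ) (hi : i ∉ Finset.range (n + 1)) :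
      ENNReal.ofReal (binomialWeight n r i) * gaussianReal (m i) (σ ^ 2).toNNReal A = 0 := by
    rw [binomialWeight, Nat.choose_eq_zero_of_lt (by simpa using hi)]
    simp
  simp only [MoG, Measure.finsetSum_apply, Measure.smul_apply, smul_eq_mul, mixture_apply _ _ hA,
    hk, tsum_eq_sum htail]
  rw [Finset.sum_range, ← hv]

end Resampling

section GaussianMixture

variable {E : Type*} [NormedAddCommGroup E] [InnerProductSpace ℝ E] [FiniteDimensional ℝ E]
  [MeasurableSpace E] [BorelSpace E] {σ C : ℝ}

theorem Indistinguishable.mixture_isoGaussian {Ω : Type*} {a δ : ℝ≥0∞} (hσ : 0 < σ) (hC : 0 < C)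
    (q : PMF Ω) {u u' : Ω → E} {b : E} {m : Ω → ℝ} (hu : ∀ ω, ‖u ω - b‖ ≤ C * m ω)
    (hu' : ∀ ω, ‖u' ω - b‖ ≤ C * m ω)
    (h : Indistinguishable a δ (mixture q fun ω => gaussianReal (-m ω) (σ ^ 2).toNNReal)
      (mixture q fun ω => gaussianReal (m ω) (σ ^ 2).toNNReal)) :
    Indistinguishable a δ (mixture q fun ω => isoGaussian (σ * C) (u ω))
      (mixture q fun ω => isoGaussian (σ * C) (u' ω)) := by
  refine h.of_forall_exists_dominating fun A hA => ?_
  obtain ⟨S, hS, hdom⟩ := exists_set_dominating_isoGaussian hσ hC b hA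
  refine ⟨S, hS, ?_, ?_⟩ <;> rw [mixture_apply _ _ hA, mixture_apply _ _ hS] <;> gcongr with ω
  · exact (hdom _ _ (hu ω)).1
  · exact (hdom _ _ (hu' ω)).2

theorem indistinguishable_of_resampling (hσ : 0 < σ) (hC : 0 < C) (α : ℝ) {β τ : Type*}
    (p : PMF β) {q : PMF τ} {F : β → τ → τ} (hF : (p.bind fun b => q.map (F b)) = q) {k : τ → ℕ}
    {n : ℕ} {r : ℝ} (hk : ∀ i, q.map k i = ENNReal.ofReal (binomialWeight n r i)) (m : ℕ → ℝ)
    {u u' : τ → E} (base : β → E) (hu : ∀ b t, ‖u (F b t) - base b‖ ≤ C * m (k t))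
    (hu' : ∀ b t, ‖u' (F b t) - base b‖ ≤ C * m (k t)) :
    Indistinguishable (ENNReal.ofReal α)
      (hockeyStick α (MoG (K := n + 1) (fun i => -m i) (fun i => binomialWeight n r i) σ)
        (MoG (K := n + 1) (fun i => m i) (fun i => binomialWeight n r i) σ))
      (mixture q fun t => isoGaussian (σ * C) (u t))
      (mixture q fun t => isoGaussian (σ * C) (u' t)) := by
  have hvar : (σ ^ 2).toNNReal ≠ 0 := (Real.toNNReal_pos.2 (pow_pos hσ 2)).ne'
  have hsplit (w : τ → E) : (mixture q fun t => isoGaussian (σ * C) (w t)) =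
      mixture p fun b => mixture q fun t => isoGaussian (σ * C) (w (F b t)) := by
    conv_lhs => rw [← hF]
    simp only [mixture_bind, mixture_map]
  rw [hsplit u, hsplit u', MoG_binomialWeight_eq_mixture hk (fun i => -m i),
    MoG_binomialWeight_eq_mixture hk m]
  refine indistinguishable_mixture_const p fun b => ?_
  refine .mixture_isoGaussian hσ hC q (hu b) (hu' b) (indistinguishable_hockeyStick ?_ α)
  exact mixture_absolutelyContinuous q fun t => (gaussianReal_absolutelyContinuous _ hvar).trans
    (gaussianReal_absolutelyContinuous' _ hvar)

end GaussianMixture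

section WithReplacement

variable {T : Type*} [Fintype T] [Nonempty T] (W : Finset T)

open Polynomial in
theorem map_card_filter_uniformOfFintype_apply [DecidableEq T] (lam i : ℕ) :
    (PMF.uniformOfFintype (Fin lam → T)).map (fun t => (Finset.univ.filter (t · ∈ W)).card) i =
      ENNReal.ofReal (binomialWeight lam ((W.card : ℝ) / Fintype.card T) i) := by
  have hT : (0 : ℝ) < Fintype.card T := mod_cast Fintype.card_pos
  have hTinv : ENNReal.ofReal (Fintype.card T : ℝ)⁻¹ = (Fintype.card T : ℝ≥0∞)⁻¹ := by
    rw [ENNReal.ofReal_inv_of_pos hT, ENNReal.ofReal_natCast]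
  have hW : ENNReal.ofReal ((W.card : ℝ) / Fintype.card T) =
      W.card * (Fintype.card T : ℝ≥0∞)⁻¹ := by
    rw [div_eq_mul_inv, ENNReal.ofReal_mul (by positivity), ENNReal.ofReal_natCast, hTinv]
  have hWc : ENNReal.ofReal (1 - (W.card : ℝ) / Fintype.card T) =
      Wᶜ.card * (Fintype.card T : ℝ≥0∞)⁻¹ := by
    rw [one_sub_div hT.ne', ← Nat.cast_sub W.card_le_univ, ← W.card_compl, div_eq_mul_inv,
      ENNReal.ofReal_mul (by positivity), ENNReal.ofReal_natCast, hTinv]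
  have hone : ∑ c : T, C (Fintype.card T : ℝ≥0∞)⁻¹ * (if c ∈ W then X else 1) =
      C (ENNReal.ofReal ((W.card : ℝ) / Fintype.card T)) * X +
        C (ENNReal.ofReal (1 - (W.card : ℝ) / Fintype.card T)) := by
    rw [hW, hWc, ← Finset.mul_sum, Finset.sum_ite]
    simp only [Finset.sum_const, Finset.filter_univ_mem, ← Finset.compl_filter, nsmul_eq_mul,
      mul_one, C_mul, map_natCast]
    ring
  refine map_eq_binomialWeight (by positivity) ?_ ?_ i
  · exact div_le_one_of_le₀ (mod_cast W.card_le_univ) hT.le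
  · rw [← hone, Fintype.sum_pow]
    refine Finset.sum_congr rfl fun t _ => ?_
    rw [PMF.uniformOfFintype_apply, Finset.prod_mul_distrib, Finset.prod_ite]
    simp [ENNReal.inv_pow]

-- The points `b j` avoid `W`, unless `W` is everything; then none of them survives the replacement.
theorem bind_map_replace_uniformOfFintype [DecidableEq T]
    [Nonempty {c // c ∈ W → W = Finset.univ}] (lam : ℕ) :
    ((PMF.uniformOfFintype (Fin lam → {c // c ∈ W → W = Finset.univ})).bind fun b =>
      (PMF.uniformOfFintype (Fin lam → T)).map fun t j => if t j ∈ W then t j else (b j : T)) =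
      PMF.uniformOfFintype (Fin lam → T) := by
  refine bind_map_eq_of_involutive _ _ _
    (fun b t j => if h : t j ∈ W then b j else ⟨t j, fun h' => absurd h' h⟩) ?_ fun b t => ?_
  · rintro ⟨b, t⟩
    have hb (j : Fin lam) (h : t j ∉ W) : (b j : T) ∉ W :=
      fun h' => h ((b j).2 h' ▸ Finset.mem_univ _)
    refine Prod.ext (funext fun j => ?_) (funext fun j => ?_) <;> by_cases h : t j ∈ W <;>
      simp [h, hb]
  · simp only [PMF.uniformOfFintype_apply]

theorem nonempty_subtype_mem_imp_eq_univ : Nonempty {c // c ∈ W → W = Finset.univ} := by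
  by_cases h : W = Finset.univ
  · exact ⟨⟨Classical.arbitrary T, fun _ => h⟩⟩
  · obtain ⟨c, hc⟩ := not_forall.1 (mt Finset.eq_univ_iff_forall.2 h)
    exact ⟨⟨c, fun h' => absurd h' hc⟩⟩

variable {E : Type*} [NormedAddCommGroup E] [InnerProductSpace ℝ E] [FiniteDimensional ℝ E]
  [MeasurableSpace E] [BorelSpace E] {σ C : ℝ}

theorem indistinguishable_sum_uniformOfFintype (hσ : 0 < σ) (hC : 0 < C) (α : ℝ) (lam : ℕ)
    {v v' : T → E} (hv : ∀ c, ‖v c‖ ≤ C) (hv' : ∀ c, ‖v' c‖ ≤ C) (hvv' : ∀ c ∉ W, v' c = v c) :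
    Indistinguishable (ENNReal.ofReal α)
      (hockeyStick α
        (MoG (K := lam + 1) (fun i => -(2 * i : ℝ))
          (fun i => binomialWeight lam ((W.card : ℝ) / Fintype.card T) i) σ)
        (MoG (K := lam + 1) (fun i => 2 * i)
          (fun i => binomialWeight lam ((W.card : ℝ) / Fintype.card T) i) σ))
      (mixture (PMF.uniformOfFintype (Fin lam → T)) fun t => isoGaussian (σ * C) (∑ j, v (t j)))
      (mixture (PMF.uniformOfFintype (Fin lam → T)) fun t =>
        isoGaussian (σ * C) (∑ j, v' (t j))) := by
  classical
  have := nonempty_subtype_mem_imp_eq_univ W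
  have hdev {w : T → E} (hw : ∀ c, ‖w c‖ ≤ C) (hwv : ∀ c ∉ W, w c = v c)
      (b : Fin lam → {c // c ∈ W → W = Finset.univ}) (t : Fin lam → T) :
      ‖∑ j, w (if t j ∈ W then t j else b j) - ∑ j, v (b j)‖ ≤
        C * (2 * (Finset.univ.filter (t · ∈ W)).card) := by
    have hterm (j : Fin lam) : ‖w (if t j ∈ W then t j else b j) - v (b j)‖ ≤
        if t j ∈ W then C * 2 else 0 := by
      split_ifs with h
      · exact (norm_sub_le_of_le (hw _) (hv _)).trans_eq (mul_two C).symm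
      · rw [hwv _ fun h' => h ((b j).2 h' ▸ Finset.mem_univ _), sub_self, norm_zero]
    rw [← Finset.sum_sub_distrib]
    refine (norm_sum_le_of_le _ fun j _ => hterm j).trans_eq ?_
    rw [← Finset.sum_filter, Finset.sum_const, nsmul_eq_mul]
    ring
  exact indistinguishable_of_resampling hσ hC α _ (bind_map_replace_uniformOfFintype W lam)
    (map_card_filter_uniformOfFintype_apply W lam) (fun i => 2 * i) _ (hdev hv fun _ _ => rfl)
    (hdev hv' hvv')

end WithReplacement

section Poisson

variable {T : ℕ} (W : Finset (Fin T)) {r : ℝ≥0} (hr : r ≤ 1)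

open Polynomial in
theorem map_card_inter_poissonSubset_apply (i : ℕ) :
    (poissonSubset T r hr).map (fun s => (s ∩ W).card) i =
      ENNReal.ofReal (binomialWeight W.card r i) := by
  have hr' : ENNReal.ofReal (1 - (r : ℝ)) = 1 - (r : ℝ≥0∞) := by
    rw [ENNReal.ofReal_sub _ r.coe_nonneg, ENNReal.ofReal_one, ENNReal.ofReal_coe_nnreal]
  have hsum : C (r : ℝ≥0∞) + C (1 - (r : ℝ≥0∞)) = 1 := by
    rw [← C_add, add_tsub_cancel_of_le (by exact_mod_cast hr), C_1]
  refine map_eq_binomialWeight r.coe_nonneg (mod_cast hr) ?_ i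
  rw [hr', ENNReal.ofReal_coe_nnreal]
  calc (∑ s, C (poissonSubset T r hr s) * X ^ (s ∩ W).card : ℝ≥0∞[X])
      = ∑ s ∈ Finset.univ.powerset, (∏ c ∈ s, C (r : ℝ≥0∞) * if c ∈ W then X else 1) *
          ∏ c ∈ Finset.univ \ s, C (1 - (r : ℝ≥0∞)) := by
        rw [Finset.powerset_univ]
        refine Finset.sum_congr rfl fun s _ => ?_
        have hcard : (Finset.univ \ s).card = T - s.card := by
          rw [← Finset.compl_eq_univ_sdiff, Finset.card_compl, Fintype.card_fin]
        rw [Finset.prod_mul_distrib, Finset.prod_const, Finset.prod_const, hcard, Finset.prod_ite,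
          Finset.prod_const, Finset.prod_const_one, mul_one, Finset.filter_mem_eq_inter]
        simp only [poissonSubset, PMF.ofFintype_apply, C_mul, C_pow]
        ring
    _ = ∏ c, (C (r : ℝ≥0∞) * (if c ∈ W then X else 1) + C (1 - (r : ℝ≥0∞))) :=
        (Finset.prod_add _ _ _).symm
    _ = (C (r : ℝ≥0∞) * X + C (1 - (r : ℝ≥0∞))) ^ W.card := by
        have hfactor (c : Fin T) : C (r : ℝ≥0∞) * (if c ∈ W then X else 1) + C (1 - (r : ℝ≥0∞)) =
            if c ∈ W then C (r : ℝ≥0∞) * X + C (1 - (r : ℝ≥0∞)) else 1 := by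
          split_ifs
          · rfl
          · rw [mul_one, hsum]
        simp only [hfactor, Finset.prod_ite_mem, Finset.univ_inter, Finset.prod_const]

theorem bind_map_sdiff_union_inter_poissonSubset :
    ((poissonSubset T r hr).bind fun s₀ =>
      (poissonSubset T r hr).map fun s => s₀ \ W ∪ s ∩ W) = poissonSubset T r hr := by
  refine bind_map_eq_of_involutive _ _ _ (fun s₀ s => s \ W ∪ s₀ ∩ W) ?_ fun s₀ s => ?_
  · rintro ⟨s₀, s⟩
    refine Prod.ext ?_ ?_ <;> ext c <;> by_cases hc : c ∈ W <;> simp [hc]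
  · have hcard (s₁ s₂ : Finset (Fin T)) :
        (s₁ \ W ∪ s₂ ∩ W).card = (s₁ \ W).card + (s₂ ∩ W).card :=
      Finset.card_union_of_disjoint
        (Finset.disjoint_of_subset_right Finset.inter_subset_right Finset.sdiff_disjoint)
    have h₀ := Finset.card_sdiff_add_card_inter s₀ W
    have h := Finset.card_sdiff_add_card_inter s W
    have hF := (s₀ \ W ∪ s ∩ W).card_le_univ
    have hG := (s \ W ∪ s₀ ∩ W).card_le_univ
    have hs₀ := s₀.card_le_univ
    have hs := s.card_le_univ
    rw [Fintype.card_fin] at hF hG hs₀ hs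
    simp only [poissonSubset, PMF.ofFintype_apply]
    rw [mul_mul_mul_comm, mul_mul_mul_comm (_ ^ s₀.card), ← pow_add, ← pow_add, ← pow_add,
      ← pow_add]
    congr 2 <;> grind

variable {E : Type*} [NormedAddCommGroup E] [InnerProductSpace ℝ E] [FiniteDimensional ℝ E]
  [MeasurableSpace E] [BorelSpace E] {σ C : ℝ}

theorem indistinguishable_sum_poissonSubset (hσ : 0 < σ) (hC : 0 < C) (α : ℝ) {v v' : Fin T → E}
    (hv : ∀ c, ‖v c‖ ≤ C) (hv' : ∀ c, ‖v' c‖ ≤ C) (hvv' : ∀ c ∉ W, v' c = v c) :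
    Indistinguishable (ENNReal.ofReal α)
      (hockeyStick α
        (MoG (K := W.card + 1) (fun i => -(i : ℝ)) (fun i => binomialWeight W.card r i) σ)
        (MoG (K := W.card + 1) (fun i => i) (fun i => binomialWeight W.card r i) σ))
      (mixture (poissonSubset T r hr) fun s => isoGaussian (σ * C) (∑ c ∈ s, v c))
      (mixture (poissonSubset T r hr) fun s => isoGaussian (σ * C) (∑ c ∈ s, v' c)) := by
  have hdev {w : Fin T → E} (hw : ∀ c, ‖w c‖ ≤ C) (hwv : ∀ c ∉ W, w c = v c)
      (s₀ s : Finset (Fin T)) :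
      ‖∑ c ∈ s₀ \ W ∪ s ∩ W, w c - ∑ c ∈ s₀ \ W, v c‖ ≤ C * (s ∩ W).card := by
    have hdisj : Disjoint (s₀ \ W) (s ∩ W) :=
      Finset.disjoint_of_subset_right Finset.inter_subset_right Finset.sdiff_disjoint
    rw [Finset.sum_union hdisj, Finset.sum_congr rfl fun c hc => hwv c (Finset.mem_sdiff.1 hc).2,
      add_sub_cancel_left]
    refine (norm_sum_le_of_le _ fun c _ => hw c).trans_eq ?_
    rw [Finset.sum_const, nsmul_eq_mul, mul_comm]
  exact indistinguishable_of_resampling hσ hC α _ (bind_map_sdiff_union_inter_poissonSubset W hr)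
    (map_card_inter_poissonSubset_apply W hr) (fun i => i) _ (hdev hv fun _ _ => rfl)
    (hdev hv' hvv')

end Poisson

section BottomLevel

theorem exists_crop_eq_off {L LC LF : ℕ} (hL : LC + LF ≤ L - LF + 1) {x x' : Series L} {t₀ : Fin L}
    (hx : ∀ i, i ≠ t₀ → x i = x' i) :
    ∃ W : Finset (Fin (L - LF + 1)), W.card = LC + LF ∧
      ∀ t ∉ W, crop LC LF x' t = crop LC LF x t := by
  let V : Finset (Fin (L - LF + 1)) :=
    Finset.univ.filter fun t => (t : ℕ) ≤ LC + t₀ ∧ LC + t₀ < t + (LC + LF)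
  have hV : V.card ≤ LC + LF := by
    have hsub : V.map Fin.valEmbedding ⊆ Finset.Icc (LC + t₀ + 1 - (LC + LF)) (LC + t₀) := by
      intro i hi
      obtain ⟨t, ht, rfl⟩ := Finset.mem_map.1 hi
      have := (Finset.mem_filter.1 ht).2
      simp only [Fin.valEmbedding_apply, Finset.mem_Icc]
      omega
    have hcard := Finset.card_le_card hsub
    rw [Finset.card_map, Nat.card_Icc] at hcard
    omega
  obtain ⟨W, hVW, hW⟩ := Finset.exists_superset_card_eq hV (by simpa using hL)
  refine ⟨W, hW, fun t ht => funext fun j => ?_⟩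
  unfold crop prependZeros
  split_ifs with h
  · refine (hx _ fun he => ht (hVW (Finset.mem_filter.2 ⟨Finset.mem_univ _, ?_⟩))).symm
    have he' : (t : ℕ) + j - LC = t₀ := congrArg Fin.val he
    omega
  · rfl

theorem norm_clip_le {D : ℕ} {C : ℝ} (hC : 0 < C) (g : EuclideanSpace ℝ (Fin D)) :
    ‖clip C g‖ ≤ C := by
  have hpos : 0 < max 1 (‖g‖ / C) := one_pos.trans_le (le_max_left _ _)
  rw [clip, norm_smul, norm_inv, Real.norm_of_nonneg hpos.le, inv_mul_le_iff₀ hpos]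
  exact (div_le_iff₀ hC).1 (le_max_right _ _)

variable {E : Type*} [NormedAddCommGroup E] [InnerProductSpace ℝ E] [FiniteDimensional ℝ E]
  [MeasurableSpace E] [BorelSpace E]

/-- The law of `∑ g a + s Z`, where `a` runs through the batch `y` and `Z` is a standard Gaussian
vector in `E`. For the clipped gradients `g` this is the only part of the training step that
depends on the data. -/
noncomputable def noisySum {A : Type*} (s : ℝ) (g : A → E) (y : Multiset A) : Measure E :=
  isoGaussian s (y.map g).sum

instance isProbabilityMeasure_noisySum {A : Type*} (s : ℝ) (g : A → E) (y : Multiset A) :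
    IsProbabilityMeasure (noisySum s g y) :=
  isProbabilityMeasure_isoGaussian _ _

theorem noisySum_add {A : Type*} (s : ℝ) (g : A → E) (y z : Multiset A) :
    noisySum s g (y + z) = (noisySum s g y).map ((z.map g).sum + ·) := by
  rw [noisySum, noisySum, map_const_add_isoGaussian, Multiset.map_add, Multiset.sum_add, add_comm]

variable {σ C : ℝ} {L LC LF lam : ℕ}
  {g : (Fin (LC + LF) → ℝ) → E} {x x' : Series L} {t₀ : Fin L}

theorem indistinguishable_sampleWithReplacement (hσ : 0 < σ) (hC : 0 < C)
    (hL : LC + LF ≤ L - LF + 1) (hg : ∀ a, ‖g a‖ ≤ C) (hx : ∀ i, i ≠ t₀ → x i = x' i) (α : ℝ) :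
    Indistinguishable (ENNReal.ofReal α)
      (hockeyStick α (pairWithReplacement (-1) L LC LF lam σ)
        (pairWithReplacement 1 L LC LF lam σ))
      (mixture (sampleWithReplacement LC LF lam x) (noisySum (σ * C) g))
      (mixture (sampleWithReplacement LC LF lam x') (noisySum (σ * C) g)) := by
  obtain ⟨W, hW, hcrop⟩ := exists_crop_eq_off hL hx
  have h := indistinguishable_sum_uniformOfFintype W hσ hC α lam (v := fun t => g (crop LC LF x t))
    (v' := fun t => g (crop LC LF x' t)) (fun _ => hg _) (fun _ => hg _)
    fun t ht => congrArg g (hcrop t ht)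
  rw [hW, Fintype.card_fin] at h
  simpa only [sampleWithReplacement, pairWithReplacement, mixture_map, noisySum,
    Multiset.map_map, Function.comp_def, neg_one_mul, one_mul, Finset.sum] using h

theorem indistinguishable_samplePoisson (hσ : 0 < σ) (hC : 0 < C)
    (hL : LC + LF ≤ L - LF + 1) (hg : ∀ a, ‖g a‖ ≤ C) (hx : ∀ i, i ≠ t₀ → x i = x' i) (α : ℝ) :
    Indistinguishable (ENNReal.ofReal α)
      (hockeyStick α (pairPoisson (-1) L LC LF lam σ) (pairPoisson 1 L LC LF lam σ))
      (mixture (samplePoisson LC LF lam x) (noisySum (σ * C) g))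
      (mixture (samplePoisson LC LF lam x') (noisySum (σ * C) g)) := by
  obtain ⟨W, hW, hcrop⟩ := exists_crop_eq_off hL hx
  have h := indistinguishable_sum_poissonSubset W
    (min_le_left 1 ((lam : ℝ≥0) / ((L - LF + 1 : ℕ) : ℝ≥0))) hσ hC α
    (v := fun t => g (crop LC LF x t)) (v' := fun t => g (crop LC LF x' t)) (fun _ => hg _)
    (fun _ => hg _) fun t ht => congrArg g (hcrop t ht)
  rw [hW, NNReal.coe_min, NNReal.coe_one, NNReal.coe_div, NNReal.coe_natCast,
    NNReal.coe_natCast] at h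
  simpa only [samplePoisson, pairPoisson, mixture_map, noisySum, Multiset.map_map,
    Function.comp_def, neg_one_mul, one_mul, Finset.sum] using h

end BottomLevel

section TopLevel

theorem tsum_map_mul {B B' : Type*} (p : PMF B) (f : B → B') (φ : B' → ℝ≥0∞) :
    ∑' b', p.map f b' * φ b' = ∑' b, p b * φ (f b) := by
  classical
  simp only [PMF.map_apply, ← ENNReal.tsum_mul_right]
  rw [ENNReal.tsum_comm]
  refine tsum_congr fun b => ?_
  simp only [ite_mul, zero_mul]
  exact tsum_ite_eq (f b) fun b' => p b * φ b'

theorem tsum_uniformOfFintype_perm_mul_ite {N N' : ℕ} (h : N' ≤ N) (n : Fin N) (a b : ℝ≥0∞) :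
    ∑' π : Equiv.Perm (Fin N), PMF.uniformOfFintype (Equiv.Perm (Fin N)) π *
        (if (π.symm n : ℕ) < N' then a else b) =
      ENNReal.ofReal (1 - (N' : ℝ) / N) * b + ENNReal.ofReal ((N' : ℝ) / N) * a := by
  have : Nonempty (Fin N) := ⟨n⟩
  have hN : (0 : ℝ) < N := mod_cast n.pos
  have hinv : (N : ℝ≥0∞)⁻¹ = ENNReal.ofReal (N : ℝ)⁻¹ := by
    rw [ENNReal.ofReal_inv_of_pos hN, ENNReal.ofReal_natCast]
  have hsel : (Finset.univ.filter fun j : Fin N => (j : ℕ) < N').card = N' := by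
    rw [Fin.card_filter_val_lt, min_eq_right h]
  have hunsel : (Finset.univ.filter fun j : Fin N => ¬ (j : ℕ) < N').card = N - N' := by
    rw [← Finset.compl_filter, Finset.card_compl, hsel, Fintype.card_fin]
  rw [← tsum_map_mul _ (fun π : Equiv.Perm (Fin N) => π.symm n)
      (fun j => if (j : ℕ) < N' then a else b),
    map_symm_apply_uniformOfFintype_perm, tsum_fintype]
  simp only [PMF.uniformOfFintype_apply, Fintype.card_fin]
  rw [← Finset.mul_sum, Finset.sum_ite, Finset.sum_const, Finset.sum_const, hsel, hunsel,
    one_sub_div hN.ne', ← Nat.cast_sub h, div_eq_inv_mul, div_eq_inv_mul,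
    ENNReal.ofReal_mul (by positivity), ENNReal.ofReal_mul (by positivity), ← hinv,
    ENNReal.ofReal_natCast, ENNReal.ofReal_natCast, nsmul_eq_mul, nsmul_eq_mul]
  ring

variable {A E : Type*} [MeasurableSpace E] {N N' L : ℕ} {bottom : Series L → PMF (Multiset A)}
  {κ : Multiset A → Measure E} [∀ y, IsProbabilityMeasure (κ y)] {δ : ℝ≥0∞} {α : ℝ}
  {x x' : Dataset N L} {n : Fin N}

theorem indistinguishable_aggregate_permuted (h : N' ≤ N)
    (hκ : ∀ y, ∃ f : E → E, Measurable f ∧ ∀ s, κ (s + y) = (κ s).map f)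
    (hne : ∀ m, m ≠ n → x m = x' m)
    (hn : Indistinguishable (ENNReal.ofReal α) δ (mixture (bottom (x n)) κ)
      (mixture (bottom (x' n)) κ)) (π : Equiv.Perm (Fin N)) :
    Indistinguishable (ENNReal.ofReal α)
      (if (π.symm n : ℕ) < N' then δ else ENNReal.ofReal (max 0 (1 - α)))
      (mixture (aggregate ((List.finRange N').map fun k => bottom (x (π (Fin.castLE h k))))) κ)
      (mixture (aggregate ((List.finRange N').map fun k =>
        bottom (x' (π (Fin.castLE h k))))) κ) := by
  have hselected {k : Fin N'} (hk : π (Fin.castLE h k) = n) : (k : ℕ) = π.symm n := by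
    rw [← hk, Equiv.symm_apply_apply, Fin.val_castLE]
  split_ifs with hlt
  · have hk : π (Fin.castLE h ⟨π.symm n, hlt⟩) = n := π.apply_symm_apply n
    refine indistinguishable_aggregate hκ (List.nodup_finRange N')
      (List.mem_finRange ⟨π.symm n, hlt⟩) (fun j hj => ?_) (by simpa only [hk] using hn)
    rw [hne _ fun hj' => hj (Fin.ext (hselected hj'))]
  · have hunselected (k : Fin N') : x (π (Fin.castLE h k)) = x' (π (Fin.castLE h k)) :=
      hne _ fun hk => hlt (hselected hk ▸ k.2)
    simp only [hunselected]
    exact indistinguishable_self α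

theorem indistinguishable_sampleBatch (h : N' ≤ N)
    (hκ : ∀ y, ∃ f : E → E, Measurable f ∧ ∀ s, κ (s + y) = (κ s).map f)
    (hne : ∀ m, m ≠ n → x m = x' m)
    (hn : Indistinguishable (ENNReal.ofReal α) δ (mixture (bottom (x n)) κ)
      (mixture (bottom (x' n)) κ)) :
    Indistinguishable (ENNReal.ofReal α)
      (ENNReal.ofReal ((1 - (N' : ℝ) / N) * max 0 (1 - α)) + ENNReal.ofReal ((N' : ℝ) / N) * δ)
      (mixture (sampleBatch h bottom x) κ) (mixture (sampleBatch h bottom x') κ) := by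
  rw [ENNReal.ofReal_mul' (le_max_left _ _), ← tsum_uniformOfFintype_perm_mul_ite h n]
  simp only [sampleBatch, mixture_bind]
  exact indistinguishable_mixture _ (indistinguishable_aggregate_permuted h hκ hne hn)

variable {D LC LF lam Lam : ℕ} {O : Type*}

theorem trainingStep_eq_map_mixture (h : Lam / lam ≤ N)
    (bottom : Series L → PMF (Multiset (Fin (LC + LF) → ℝ)))
    (f : EuclideanSpace ℝ (Fin D) → (Fin LC → ℝ) → O) (loss : O → (Fin LF → ℝ) → ℝ)
    (θ : EuclideanSpace ℝ (Fin D)) (η σ C : ℝ) (x : Dataset N L) :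
    trainingStep h bottom f loss θ η σ C x =
      (mixture (sampleBatch h bottom x)
        (noisySum (σ * C) fun a => clip C (subsequenceGradient f loss θ a))).map
          fun w => θ - η • ((1 / (Lam : ℝ)) • w) := by
  rw [trainingStep, map_mixture _ _ (by fun_prop)]
  refine congrArg _ (funext fun y => ?_)
  rw [noisySum, isoGaussian, Measure.map_map (by fun_prop) (by fun_prop)]
  rfl

theorem privacyProfile_trainingStep_le (h : Lam / lam ≤ N)
    {bottom : Series L → PMF (Multiset (Fin (LC + LF) → ℝ))}
    {f : EuclideanSpace ℝ (Fin D) → (Fin LC → ℝ) → O} {loss : O → (Fin LF → ℝ) → ℝ}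
    {θ : EuclideanSpace ℝ (Fin D)} (η : ℝ) {σ C : ℝ}
    (hbottom : ∀ {x x' : Series L} {t₀ : Fin L}, (∀ i, i ≠ t₀ → x i = x' i) →
      Indistinguishable (ENNReal.ofReal α) δ
        (mixture (bottom x) (noisySum (σ * C) fun a => clip C (subsequenceGradient f loss θ a)))
        (mixture (bottom x') (noisySum (σ * C) fun a => clip C (subsequenceGradient f loss θ a)))) :
    privacyProfile (trainingStep (N := N) h bottom f loss θ η σ C) α ≤
      ENNReal.ofReal ((1 - ((Lam / lam : ℕ) : ℝ) / N) * max 0 (1 - α)) +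
        ENNReal.ofReal (((Lam / lam : ℕ) : ℝ) / N) * δ := by
  refine iSup_le fun x => iSup_le fun x' => iSup_le fun ⟨n, hne, t₀, ht₀⟩ => ?_
  have hx (i : Fin L) (hi : i ≠ t₀) : x n i = x' n i := ht₀ i (by grind)
  have hstep : Measurable fun w : EuclideanSpace ℝ (Fin D) => θ - η • ((1 / (Lam : ℝ)) • w) := by
    fun_prop
  simp only [trainingStep_eq_map_mixture]
  have := Measure.isProbabilityMeasure_map (μ := mixture (sampleBatch h bottom x')
    (noisySum (σ * C) fun a => clip C (subsequenceGradient f loss θ a))) hstep.aemeasurable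
  exact ((indistinguishable_sampleBatch h (fun y => ⟨_, by fun_prop, (noisySum_add _ _ · y)⟩) hne
    (hbottom hx)).map hstep).hockeyStick_le

end TopLevel

end BilevelForecasting

theorem mainTheorem9 {N L LC LF D lam Lam : ℕ} {O : Type*}
    (hlam : 1 ≤ lam) (hLam : 1 ≤ Lam) (hN : Lam / lam ≤ N)
    (hLF : LF ≤ L) (hL : LC + LF ≤ L - LF + 1)
    (f : EuclideanSpace ℝ (Fin D) → (Fin LC → ℝ) → O) (loss : O → (Fin LF → ℝ) → ℝ)
    (θ : EuclideanSpace ℝ (Fin D)) {η σ C : ℝ} (hη : η ≠ 0) (hσ : 0 < σ) (hC : 0 < C)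
    {ρ : ℝ} (hρ : ρ = ((Lam / lam : ℕ) : ℝ) / (N : ℝ)) :
    (∀ α : ℝ, 0 ≤ α →
      BilevelForecasting.privacyProfile
          (BilevelForecasting.trainingStep (N := N) (L := L) hN
            (BilevelForecasting.sampleWithReplacement LC LF lam) f loss θ η σ C) α
        ≤ ENNReal.ofReal ((1 - ρ) * max 0 (1 - α)) +
          ENNReal.ofReal ρ * BilevelForecasting.hockeyStick α
            (BilevelForecasting.pairWithReplacement (-1) L LC LF lam σ)
            (BilevelForecasting.pairWithReplacement 1 L LC LF lam σ)) ∧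
    (∀ α : ℝ, 0 ≤ α →
      BilevelForecasting.privacyProfile
          (BilevelForecasting.trainingStep (N := N) (L := L) hN
            (BilevelForecasting.samplePoisson LC LF lam) f loss θ η σ C) α
        ≤ ENNReal.ofReal ((1 - ρ) * max 0 (1 - α)) +
          ENNReal.ofReal ρ * BilevelForecasting.hockeyStick α
            (BilevelForecasting.pairPoisson (-1) L LC LF lam σ)
            (BilevelForecasting.pairPoisson 1 L LC LF lam σ)) := by
  subst hρ
  have hclip := fun a => BilevelForecasting.norm_clip_le hC
    (BilevelForecasting.subsequenceGradient f loss θ a)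
  constructor <;> intro α _ <;>
    refine BilevelForecasting.privacyProfile_trainingStep_le hN η fun hx => ?_
  · exact BilevelForecasting.indistinguishable_sampleWithReplacement hσ hC hL hclip hx α
  · exact BilevelForecasting.indistinguishable_samplePoisson hσ hC hL hclip hx α
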